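/- Let $n$ be a positive integer, $T>0$ and $\omega=2\pi/T$. Let $A,Q:\mathbb R\to\mathbb R^{n\times n}$ be $T$-periodic functions whose entries belong to $L^\infty([0,T])$. For a $T$-periodic scalar function $x$ write $x_k=\frac1T\int_0^T x(\tau)e^{-j\omega k\tau}\,d\tau$, $k\in\mathbb Z$, for its phasors, and for a $T$-periodic matrix function $X$ let $X_k$ be the matrix of the $k$-th phasors of its entries, $X(z)=\sum_{k\in\mathbb Z}X_kz^k$ its symbol, and $\mathcal X=\mathcal T(X)=(\mathcal X_{ij})_{1\le i,j\le n}$ its block Toeplitz matrix, where $\mathcal X_{ij}$ is the infinite Toeplitz matrix with entries $(X_{k-l})_{ij}$, $k,l\in\mathbb Z$. Put $\mathcal N=\mathrm{Id}_n\otimes\mathrm{diag}(j\omega k,\ k\in\mathbb Z)$. Symbols are multiplied by the Cauchy product, $(\mathbb 1_{n,n}\otimes N(z))\cdot X(z)=\sum_k j\omega k X_kz^k$, and $\|X(z)\|_{\ell^2}=\big(\sum_{k\in\mathbb Z}\sum_{i,j}|(X_k)_{ij}|^2\big)^{1/2}$. Assume that the harmonic Lyapunov equation $$\mathcal P(\mathcal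 A-\mathcal N)+(\mathcal A-\mathcal N)^*\mathcal P+\mathcal Q=0,\qquad \mathcal A=\mathcal T(A),\ \mathcal Q=\mathcal T(Q),$$ has exactly one solution $\mathcal P=\mathcal T(P)$ with square summable phasors $(P_k)_{k\in\mathbb Z}$. For $m\ge 0$ let $\mathcal A_m,\mathcal N_m$ be the matrices obtained from $\mathcal A,\mathcal N$ by keeping in each of the $n\times n$ blocks only the rows and columns of index $|k|\le m$, and let $\mathrm{Id}_n\circ\mathcal A_m^*$ be the block matrix whose block $(i,j)$ is $\mathrm{Id}_n\otimes(\mathcal A_m^*)_{ij}$, where $(\mathcal A_m^*)_{ij}$ is the block $(i,j)$ of $\mathcal A_m^*$. The $m$-truncated solution $\tilde{\mathbf P}_m$ is defined by $$\mathrm{col}(\tilde{\mathbf P}_m)=-\big(\mathrm{Id}_n\otimes(\mathcal A_m-\mathcal N_m)^*+\mathrm{Id}_n\circ\mathcal A_m^*\big)^{-1}\mathrm{col}(\mathbf Q|_m),$$ where $\mathbf Q|_m$ is the matrix whose entries are the vectors of the phasors of order $|k|\le m$ of the entries of $Q$, and $\mathrm{col}$ stacks the columns of a matrix. Let $\tilde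 P_m(z)$ be the symbol associated with $\tilde{\mathbf P}_m$; its coefficients of order $|k|>m$ are $0$. Then for every $\varepsilon>0$ there is $m_0$ such that for all $m\ge m_0$ the matrix $\mathrm{Id}_n\otimes(\mathcal A_m-\mathcal N_m)^*+\mathrm{Id}_n\circ\mathcal A_m^*$ is invertible (so that $\tilde{\mathbf P}_m$ is well defined), the coefficients of $A(z)'\tilde P_m(z)+\tilde P_m(z)A(z)+(\mathbb 1_{n,n}\otimes N(z))\cdot\tilde P_m(z)+Q(z)$ are square summable, and $$\big\|A(z)'\tilde P_m(z)+\tilde P_m(z)A(z)+(\mathbb 1_{n,n}\otimes N(z))\cdot\tilde P_m(z)+Q(z)\big\|_{\ell^2}<\varepsilon .$$ -/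

import Mathlib

open scoped Matrix Kronecker

noncomputable section

namespace Harmonic

/-- The `k`-th phasor `(1/T) ∫₀ᵀ a(τ) e^{-jωkτ} dτ`, `ω = 2π/T`, of a `T`-periodic signal. -/
def phasor (T : ℝ) (a : ℝ → ℂ) (k : ℤ) : ℂ :=
  (1 / T : ℂ) * ∫ τ in (0 : ℝ)..T,
    a τ * Complex.exp (-(Complex.I * ((2 * Real.pi / T : ℝ) : ℂ) * (k : ℂ) * (τ : ℂ)))

/-- A matrix symbol `X(z) = ∑ₖ Xₖ zᵏ`, given by its bilateral sequence of coefficients. -/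
abbrev MatSymbol (n : ℕ) := ℤ → Matrix (Fin n) (Fin n) ℂ

/-- The symbol of a real `T`-periodic matrix function: its coefficients are the phasors
of the entries. -/
def symbolOf {n : ℕ} (T : ℝ) (A : ℝ → Matrix (Fin n) (Fin n) ℝ) : MatSymbol n :=
  fun k => Matrix.of fun i j => phasor T (fun t => (A t i j : ℂ)) k

/-- The transposed symbol `X(z)'`. -/
def symbolTranspose {n : ℕ} (X : MatSymbol n) : MatSymbol n := fun k => (X k)ᵀ

/-- The product `X(z) Y(z)` of two symbols (Cauchy product of the coefficients). -/
def symbolMul {n : ℕ} (X Y : MatSymbol n) : MatSymbol n :=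
  fun k => ∑' r : ℤ, X (k - r) * Y r

/-- The Hadamard product `(𝟙 ⊗ N(z)) · X(z)` with `N(z) = ∑ₖ jωk zᵏ`: every coefficient of
every entry is multiplied by `jωk`. -/
def symbolN {n : ℕ} (T : ℝ) (X : MatSymbol n) : MatSymbol n :=
  fun k => (Complex.I * ((2 * Real.pi / T : ℝ) : ℂ) * (k : ℂ)) • X k

/-- The coefficients of the symbol are square summable. -/
def SqSummable {n : ℕ} (X : MatSymbol n) : Prop :=
  Summable fun k : ℤ => ∑ i, ∑ j, ‖X k i j‖ ^ 2

/-- The `ℓ²`-norm `‖X(z)‖ = ‖col(X)‖` of a symbol, for square summable coefficients. -/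
def ell2Norm {n : ℕ} (X : MatSymbol n) : ℝ :=
  Real.sqrt (∑' k : ℤ, ∑ i, ∑ j, ‖X k i j‖ ^ 2)

/-- The left-hand side `A(z)' P(z) + P(z) A(z) + (𝟙 ⊗ N(z)) · P(z) + Q(z)` of the symbol
Lyapunov equation. -/
def symbolLyapunov {n : ℕ} (T : ℝ) (A Q P : MatSymbol n) : MatSymbol n :=
  symbolMul (symbolTranspose A) P + symbolMul P A + symbolN T P + Q

/-- The block Toeplitz infinite matrix of a symbol: the block `(i, j)` is the Toeplitz
matrix with entries `(X_{k-l})ᵢⱼ`, `k, l ∈ ℤ`. -/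
def blockToeplitz {n : ℕ} (X : MatSymbol n) : Matrix (Fin n × ℤ) (Fin n × ℤ) ℂ :=
  Matrix.of fun p q => X (p.2 - q.2) p.1 q.1

/-- `𝒩 = Id ⊗ diag(jωk, k ∈ ℤ)`. -/
def harmonicN (n : ℕ) (T : ℝ) : Matrix (Fin n × ℤ) (Fin n × ℤ) ℂ :=
  Matrix.diagonal fun p => Complex.I * ((2 * Real.pi / T : ℝ) : ℂ) * (p.2 : ℂ)

/-- The product of two infinite matrices. -/
def infMul {ι : Type*} (M N : Matrix ι ι ℂ) : Matrix ι ι ℂ :=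
  Matrix.of fun p q => ∑' r : ι, M p r * N r q

/-- `P` has square summable phasors and its block Toeplitz matrix `𝒫` solves the harmonic
Lyapunov equation `𝒫 (𝒜 - 𝒩) + (𝒜 - 𝒩)* 𝒫 + 𝒬 = 0`. -/
def IsHarmonicLyapunovSolution {n : ℕ} (T : ℝ) (A Q P : MatSymbol n) : Prop :=
  SqSummable P ∧
    infMul (blockToeplitz P) (blockToeplitz A - harmonicN n T)
      + infMul (blockToeplitz A - harmonicN n T)ᴴ (blockToeplitz P) + blockToeplitz Q = 0

/-- The harmonics `k` with `|k| ≤ m`. -/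
abbrev Modes (m : ℕ) := {k : ℤ // k ∈ Finset.Icc (-(m : ℤ)) m}

/-- The `m`-truncation of a block infinite matrix (each of its blocks is truncated). -/
def trunc {n : ℕ} (m : ℕ) (M : Matrix (Fin n × ℤ) (Fin n × ℤ) ℂ) :
    Matrix (Fin n × Modes m) (Fin n × Modes m) ℂ :=
  M.submatrix (fun p => (p.1, (p.2 : ℤ))) (fun p => (p.1, (p.2 : ℤ)))

/-- `Id ∘ M`: the block matrix whose block `(i, j)` is `Id ⊗ Mᵢⱼ`, where `Mᵢⱼ` is the
block `(i, j)` of `M`. -/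
def idCirc {n : ℕ} {κ : Type*} (M : Matrix (Fin n × κ) (Fin n × κ) ℂ) :
    Matrix (Fin n × (Fin n × κ)) (Fin n × (Fin n × κ)) ℂ :=
  Matrix.of fun p q =>
    ((1 : Matrix (Fin n) (Fin n) ℂ) ⊗ₖ (Matrix.of fun k l => M (p.1, k) (q.1, l))) p.2 q.2

/-- `Id ⊗ (𝒜ₘ - 𝒩ₘ)* + Id ∘ 𝒜ₘ*`. -/
def truncLyapunovMatrix {n : ℕ} (T : ℝ) (A : MatSymbol n) (m : ℕ) :
    Matrix (Fin n × (Fin n × Modes m)) (Fin n × (Fin n × Modes m)) ℂ :=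
  (1 : Matrix (Fin n) (Fin n) ℂ) ⊗ₖ
      (trunc m (blockToeplitz A) - trunc m (harmonicN n T))ᴴ
    + idCirc (trunc m (blockToeplitz A))ᴴ

/-- `col(X|ₘ)`: the columns of `X` are stacked, and every entry is replaced by the vector of
its coefficients of order `|k| ≤ m`. The index `(j, (i, k))` is the coefficient of order `k`
of the entry `(i, j)`. -/
def colTrunc {n : ℕ} (m : ℕ) (X : MatSymbol n) : Fin n × (Fin n × Modes m) → ℂ :=
  fun p => X p.2.2 p.2.1 p.1

/-- The symbol of the `m`-truncated solution, which is defined by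
`col(P̃ₘ) = -(Id ⊗ (𝒜ₘ - 𝒩ₘ)* + Id ∘ 𝒜ₘ*)⁻¹ col(Q|ₘ)` and has no coefficients of order
`|k| > m`. -/
def truncSolution {n : ℕ} (T : ℝ) (A Q : MatSymbol n) (m : ℕ) : MatSymbol n :=
  fun k => Matrix.of fun i j =>
    if h : k ∈ Finset.Icc (-(m : ℤ)) m then
      (-((truncLyapunovMatrix T A m)⁻¹ *ᵥ colTrunc m Q)) (j, (i, ⟨k, h⟩))
    else 0

end Harmonic

end

/-! In coefficients the Lyapunov equation reads `M P + N·P + Q = 0`, where `M P = A'P + PA` is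
bounded on matrices of `ℓ²` sequences (bounded functions give bounded Laurent operators,
`exists_laurent`) and `N` multiplies order `k` by `jωk`. Since `jωk` vanishes at `k = 0`, one
divides by `1 + N` instead: the equation becomes `(1 + K)P = -(1 + N)⁻¹Q` with `K = (1 + N)⁻¹(M -
1)`, compact because `1/(1 + jωk)` tends to `0`. Uniqueness makes `1 + K` injective, hence
invertible by the Fredholm alternative (`isUnit_one_add_perturbation`).

Truncation to order `m` replaces `K` by `C K`, with `C` the cut-off (`truncated_iff`). As `C K`
tends to `K` in norm, `1 + C K` is eventually invertible and the truncated solutions converge in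
`ℓ²` (`exists_tendsto_truncatedSolution`). The residual is the part of `M P̃ₘ + Q` of order above
`m` (`ActsBy.symbolLyapunov_eq`); it tends to `0` because `M P̃ₘ + Q` converges. The limit need not
be identified. -/

noncomputable section

namespace Harmonic

open MeasureTheory AddCircle Filter Topology

/-- The Hilbert space `ℓ²(ℤ, ℂ)`. -/
abbrev Ell2 : Type := lp (fun _ : ℤ => ℂ) 2

theorem evalCLM_apply (k : ℤ) (x : Ell2) : lp.evalCLM ℂ (fun _ : ℤ => ℂ) 2 k x = x k := rfl

/-! ### Phasors as Fourier coefficients, and Laurent operators -/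

section Laurent

variable {T : ℝ} [hT : Fact (0 < T)]

theorem phasor_eq_fourierCoeff (a : ℝ → ℂ) (k : ℤ) :
    phasor T a k = fourierCoeff (AddCircle.liftIoc T 0 a) k := by
  rw [fourierCoeff_eq_intervalIntegral _ _ 0, zero_add, phasor, Complex.real_smul]
  congr 1
  · simp
  · refine intervalIntegral.integral_congr_ae (Eventually.of_forall fun x hx => ?_)
    rw [Set.uIoc_of_le hT.out.le] at hx
    rw [AddCircle.liftIoc_zero_coe_apply hx, fourier_coe_apply, smul_eq_mul, mul_comm]
    congr 2
    push_cast
    ring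

theorem fourierCoeff_mul_fourier (f : AddCircle T → ℂ) (k l : ℤ) :
    fourierCoeff (fun t => f t * fourier l t) k = fourierCoeff f (k - l) := by
  unfold fourierCoeff
  refine integral_congr_ae (Eventually.of_forall fun t => ?_)
  have : -(k - l) = -k + l := by ring
  simp only [smul_eq_mul, this, fourier_add]
  ring

/-- Multiplication by an essentially bounded function on `L²`. -/
def mulL2 (a : Lp ℂ ⊤ (@haarAddCircle T hT)) :
    Lp ℂ 2 (@haarAddCircle T hT) →L[ℂ] Lp ℂ 2 (@haarAddCircle T hT) :=
  (ContinuousLinearMap.mul ℂ ℂ).holderL (@haarAddCircle T hT) ⊤ 2 2 a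

/-- The Laurent operator on `ℓ²(ℤ)` of an essentially bounded function. -/
def laurent (a : Lp ℂ ⊤ (@haarAddCircle T hT)) : Ell2 →L[ℂ] Ell2 :=
  (fourierBasis (T := T)).repr.toContinuousLinearEquiv.toContinuousLinearMap ∘L mulL2 a ∘L
    (fourierBasis (T := T)).repr.symm.toContinuousLinearEquiv.toContinuousLinearMap

theorem fourierBasis_repr_mulL2_fourierLp (a : Lp ℂ ⊤ (@haarAddCircle T hT)) (k l : ℤ) :
    fourierBasis.repr (mulL2 a (fourierLp 2 l)) k = fourierCoeff a (k - l) := by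
  rw [fourierBasis_repr, ← fourierCoeff_mul_fourier]
  refine congrFun (fourierCoeff_congr_ae ?_) k
  have h1 := (ContinuousLinearMap.mul ℂ ℂ).coeFn_holder (r := 2) a (fourierLp 2 l)
  filter_upwards [h1, coeFn_fourierLp (T := T) 2 l] with t h1 h2
  simp only [mulL2, ContinuousLinearMap.holderL_apply_apply]
  rw [h1, h2]
  rfl

/-- Expand `x` in the Fourier basis and push the sum through continuous linear maps; the image of
each basis vector is a shifted coefficient sequence. -/
theorem hasSum_laurent (a : Lp ℂ ⊤ (@haarAddCircle T hT)) (x : Ell2) (k : ℤ) :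
    HasSum (fun l => fourierCoeff a (k - l) * x l) (laurent a x k) := by
  have h := ((fourierBasis (T := T)).hasSum_repr_symm x).mapL
    ((lp.evalCLM ℂ (fun _ : ℤ => ℂ) 2 k) ∘L
      (fourierBasis (T := T)).repr.toContinuousLinearEquiv.toContinuousLinearMap ∘L mulL2 a)
  refine HasSum.congr_fun (show HasSum _ (laurent a x k) from h) fun l => ?_
  rw [map_smul, smul_eq_mul, mul_comm, ← fourierBasis_repr_mulL2_fourierLp, coe_fourierBasis]
  rfl

theorem exists_laurent (a : ℝ → ℂ) (ha : MemLp a ⊤ (volume.restrict (Set.Ioc 0 T))) :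
    ∃ L : Ell2 →L[ℂ] Ell2, ∀ x k, HasSum (fun l => phasor T a (k - l) * x l) (L x k) := by
  have h : MemLp (AddCircle.liftIoc T 0 a) ⊤ (@haarAddCircle T hT) :=
    (MemLp.memLp_liftIoc (t := 0) (by rwa [zero_add])).haarAddCircle
  refine ⟨laurent h.toLp, fun x k => ?_⟩
  convert hasSum_laurent h.toLp x k using 3
  rw [phasor_eq_fourierCoeff, fourierCoeff_congr_ae h.coeFn_toLp]

theorem exists_phasor_ell2 (a : ℝ → ℂ) (ha : MemLp a 2 (volume.restrict (Set.Ioc 0 T))) :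
    ∃ x : Ell2, ∀ k, x k = phasor T a k := by
  have h : MemLp (AddCircle.liftIoc T 0 a) 2 (@haarAddCircle T hT) :=
    (MemLp.memLp_liftIoc (t := 0) (by rwa [zero_add])).haarAddCircle
  refine ⟨fourierBasis.repr h.toLp, fun k => ?_⟩
  rw [fourierBasis_repr, phasor_eq_fourierCoeff, fourierCoeff_congr_ae h.coeFn_toLp]

end Laurent

/-- Realness is what makes the adjoint of the Toeplitz matrix of `A` act as the transposed symbol
`A'`. -/
theorem star_phasor_ofReal (T : ℝ) (a : ℝ → ℝ) (k : ℤ) :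
    star (phasor T (fun t => (a t : ℂ)) k) = phasor T (fun t => (a t : ℂ)) (-k) := by
  simp only [phasor, Complex.star_def, map_mul, map_div₀, map_one, Complex.conj_ofReal]
  rw [← intervalIntegral.intervalIntegral_conj]
  congr 2
  ext t
  rw [map_mul, ← Complex.exp_conj]
  simp [-Complex.ofReal_mul, -Complex.ofReal_div]

/-! ### Diagonal operators and cut-offs on `ℓ²(ℤ)` -/

/-- The bounded diagonal operator with entries `c k` on `ℓ²(ℤ)`. -/
def diagOp (c : ℤ → ℂ) (C : ℝ) (hC : ∀ k, ‖c k‖ ≤ C) : Ell2 →L[ℂ] Ell2 :=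
  have key : ∀ (x : Ell2) (k : ℤ), ‖c k * x k‖ ≤ ‖((C : ℂ) • x) k‖ := fun x k => by
    rw [lp.coeFn_smul, Pi.smul_apply, smul_eq_mul, norm_mul, norm_mul, Complex.norm_real]
    exact mul_le_mul_of_nonneg_right ((hC k).trans (le_abs_self C)) (norm_nonneg _)
  LinearMap.mkContinuous
    { toFun := fun x => ⟨fun k => c k * x k, (lp.memℓp ((C : ℂ) • x)).mono' (key x)⟩
      map_add' := fun x y => lp.ext <| funext fun k => mul_add _ _ _
      map_smul' := fun r x => lp.ext <| funext fun k => mul_left_comm _ _ _ }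
    C fun x => by
      refine (lp.norm_mono two_ne_zero (key x)).trans_eq ?_
      rw [norm_smul, Complex.norm_real, Real.norm_of_nonneg ((norm_nonneg _).trans (hC 0))]

@[simp]
theorem diagOp_apply (c : ℤ → ℂ) (C : ℝ) (hC : ∀ k, ‖c k‖ ≤ C) (x : Ell2) (k : ℤ) :
    diagOp c C hC x k = c k * x k := rfl

theorem norm_le_of_apply_le (L : Ell2 →L[ℂ] Ell2) (C : ℝ) (hC : 0 ≤ C)
    (h : ∀ x k, ‖L x k‖ ≤ C * ‖x k‖) : ‖L‖ ≤ C := by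
  refine L.opNorm_le_bound hC fun x => ?_
  have := lp.norm_mono (x := L x) (y := (C : ℂ) • x) two_ne_zero fun k => by
    rw [lp.coeFn_smul, Pi.smul_apply, norm_smul, Complex.norm_real, Real.norm_of_nonneg hC]
    exact h x k
  rwa [norm_smul, Complex.norm_real, Real.norm_of_nonneg hC] at this

/-- The orthogonal projection of `ℓ²(ℤ)` onto the sequences supported in `[-m, m]`. -/
def cutoff (m : ℕ) : Ell2 →L[ℂ] Ell2 :=
  ∑ k ∈ Finset.Icc (-(m : ℤ)) m,
    lp.singleContinuousLinearMap ℂ (fun _ : ℤ => ℂ) 2 k ∘L lp.evalCLM ℂ (fun _ : ℤ => ℂ) 2 k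

theorem cutoff_eq_sum (m : ℕ) (x : Ell2) :
    cutoff m x = ∑ k ∈ Finset.Icc (-(m : ℤ)) m, lp.single 2 k (x k) := by
  simp [cutoff, evalCLM_apply]

theorem cutoff_apply (m : ℕ) (x : Ell2) (k : ℤ) :
    cutoff m x k = if k ∈ Finset.Icc (-(m : ℤ)) m then x k else 0 := by
  rw [cutoff_eq_sum, lp.coeFn_sum, Finset.sum_apply]
  simp only [lp.single_apply, Finset.sum_pi_single]

theorem isCompactOperator_cutoff (m : ℕ) : IsCompactOperator (cutoff m) := by
  refine Submodule.sum_mem (compactOperator (RingHom.id ℂ) Ell2 Ell2) (fun k _ => ?_)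
  have h : IsCompactOperator (lp.evalCLM ℂ (fun _ : ℤ => ℂ) 2 k) :=
    isCompactOperator_of_locallyCompactSpace_dom _
  exact h.clm_comp (lp.singleContinuousLinearMap ℂ (fun _ : ℤ => ℂ) 2 k)

theorem tendsto_cutoff_apply (x : Ell2) : Tendsto (fun m => cutoff m x) atTop (𝓝 x) := by
  simp only [cutoff_eq_sum]
  have h : Tendsto (fun s : Finset ℤ => ∑ k ∈ s, (lp.single 2 k (x k) : Ell2)) atTop (𝓝 x) :=
    lp.hasSum_single (by simp) x
  exact h.comp (Finset.tendsto_Icc_neg (R := ℤ))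

theorem norm_cutoff_le (m : ℕ) : ‖cutoff m‖ ≤ 1 := by
  refine norm_le_of_apply_le _ 1 zero_le_one fun x k => ?_
  rw [cutoff_apply]
  split_ifs <;> simp

/-- Diagonal operators with entries tending to zero are approximated by their cut-offs. -/
theorem tendsto_cutoff_comp_diagOp (c : ℤ → ℂ) (C : ℝ) (hC : ∀ k, ‖c k‖ ≤ C)
    (h0 : Tendsto c cofinite (𝓝 0)) :
    Tendsto (fun m => cutoff m ∘L diagOp c C hC) atTop (𝓝 (diagOp c C hC)) := by
  rw [Metric.tendsto_atTop]
  intro ε hε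
  have hfin : {k | ε / 2 ≤ ‖c k‖}.Finite := by
    have := h0.norm.eventually_lt_const (u := ε / 2) (by simpa using half_pos hε)
    simpa only [Filter.eventually_cofinite, not_lt] using this
  obtain ⟨N, hN⟩ := eventually_atTop.1 ((Finset.tendsto_Icc_neg (R := ℤ)).eventually_ge_atTop hfin.toFinset)
  refine ⟨N, fun m hm => ?_⟩
  rw [dist_eq_norm]
  refine lt_of_le_of_lt (norm_le_of_apply_le _ (ε / 2) (half_pos hε).le fun x k => ?_)
    (half_lt_self hε)
  change ‖cutoff m (diagOp c C hC x) k - diagOp c C hC x k‖ ≤ _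
  rw [cutoff_apply, diagOp_apply]
  split_ifs with hk
  · rw [sub_self, norm_zero]
    positivity
  · rw [zero_sub, norm_neg, norm_mul]
    refine mul_le_mul_of_nonneg_right (le_of_not_ge fun h => hk ?_) (norm_nonneg _)
    exact hN m hm (hfin.mem_toFinset.2 h)

theorem hasSum_prod_fintype {α β : Type*} [Fintype α] {g : α × β → ℂ} {s : α → ℂ}
    (h : ∀ a, HasSum (fun b => g (a, b)) (s a)) : HasSum g (∑ a, s a) := by
  classical
  have key : ∀ a, HasSum (fun r : α × β => if r.1 = a then g r else 0) (s a) := fun a => by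
    rw [← (Prod.mk_right_injective a).hasSum_iff]
    · simpa [Function.comp_def] using h a
    · rintro ⟨a', b⟩ hr
      exact if_neg fun e => hr ⟨b, by simp_all⟩
  simpa using hasSum_sum fun a (_ : a ∈ Finset.univ) => key a

/-! ### Coefficient form of the symbol and Toeplitz equations -/

variable {n : ℕ}

/-- Matrices of square summable sequences. -/
abbrev MatEll2 (n : ℕ) : Type := Fin n × Fin n → Ell2

/-- The symbol whose entries have the given square summable coefficients. -/
def toSymbol (f : MatEll2 n) : MatSymbol n := fun k => Matrix.of fun i j => f (i, j) k

@[simp]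
theorem toSymbol_apply (f : MatEll2 n) (k : ℤ) (i j : Fin n) : toSymbol f k i j = f (i, j) k := rfl

theorem toSymbol_injective : Function.Injective (toSymbol (n := n)) := fun _ _ h =>
  funext fun p => lp.ext <| funext fun k => congrFun (congrFun (congrFun h k) p.1) p.2

theorem hasSum_norm_sq (x : Ell2) : HasSum (fun k => ‖x k‖ ^ 2) (‖x‖ ^ 2) := by
  simpa using lp.hasSum_norm (p := 2) (by simp) x

theorem hasSum_toSymbol (f : MatEll2 n) :
    HasSum (fun k : ℤ => ∑ i, ∑ j, ‖toSymbol f k i j‖ ^ 2) (∑ i, ∑ j, ‖f (i, j)‖ ^ 2) :=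
  hasSum_sum fun i _ => hasSum_sum fun j _ => hasSum_norm_sq (f (i, j))

theorem sqSummable_toSymbol (f : MatEll2 n) : SqSummable (toSymbol f) :=
  (hasSum_toSymbol f).summable

theorem ell2Norm_toSymbol (f : MatEll2 n) :
    ell2Norm (toSymbol f) = Real.sqrt (∑ i, ∑ j, ‖f (i, j)‖ ^ 2) := by
  rw [ell2Norm, (hasSum_toSymbol f).tsum_eq]

theorem tendsto_ell2Norm_toSymbol {ι : Type*} {l : Filter ι} {f : ι → MatEll2 n}
    (hf : Tendsto f l (𝓝 0)) : Tendsto (fun a => ell2Norm (toSymbol (f a))) l (𝓝 0) := by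
  simp only [ell2Norm_toSymbol]
  have hc : Continuous fun g : MatEll2 n => Real.sqrt (∑ i, ∑ j, ‖g (i, j)‖ ^ 2) := by fun_prop
  simpa [Function.comp_def] using (hc.tendsto 0).comp hf

theorem SqSummable.exists_toSymbol {P : MatSymbol n} (hP : SqSummable P) :
    ∃ f : MatEll2 n, toSymbol f = P := by
  refine ⟨fun p => ⟨fun k => P k p.1 p.2, memℓp_gen ?_⟩, rfl⟩
  simp only [ENNReal.toReal_ofNat, Real.rpow_ofNat]
  refine Summable.of_nonneg_of_le (fun k => sq_nonneg _) (fun k => ?_) hP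
  refine le_trans ?_ (Finset.single_le_sum (f := fun i => ∑ j, ‖P k i j‖ ^ 2)
    (fun i _ => by positivity) (Finset.mem_univ p.1))
  exact Finset.single_le_sum (f := fun j => ‖P k p.1 j‖ ^ 2)
    (fun j _ => by positivity) (Finset.mem_univ p.2)

/-- The operator `P ↦ A' P + P A` on matrices of square summable sequences, where the entries
of `A` act by the operators `L i j`. -/
def lyapunovOp (L : Fin n → Fin n → Ell2 →L[ℂ] Ell2) : MatEll2 n →L[ℂ] MatEll2 n :=
  ContinuousLinearMap.pi fun p =>
    ∑ r, L r p.1 ∘L ContinuousLinearMap.proj (r, p.2) +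
      ∑ r, L r p.2 ∘L ContinuousLinearMap.proj (p.1, r)

theorem lyapunovOp_apply (L : Fin n → Fin n → Ell2 →L[ℂ] Ell2) (f : MatEll2 n) (i j : Fin n)
    (k : ℤ) : lyapunovOp L f (i, j) k =
      ∑ r, L r i (f (r, j)) k + ∑ r, L r j (f (i, r)) k := by
  have h : lyapunovOp L f (i, j) = ∑ r, L r i (f (r, j)) + ∑ r, L r j (f (i, r)) := by
    simp [lyapunovOp]
  rw [← evalCLM_apply, h, map_add, map_sum, map_sum]
  rfl

/-- The entries of the symbol `A` act on square summable sequences by the operators `L i j`. -/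
def ActsBy (A : MatSymbol n) (L : Fin n → Fin n → Ell2 →L[ℂ] Ell2) : Prop :=
  ∀ i j x k, HasSum (fun l => A (k - l) i j * x l) (L i j x k)

variable {A : MatSymbol n} {L : Fin n → Fin n → Ell2 →L[ℂ] Ell2}

theorem ActsBy.symbolMul_transpose (hL : ActsBy A L) (f : MatEll2 n) (k : ℤ) (i j : Fin n) :
    symbolMul (symbolTranspose A) (toSymbol f) k i j = ∑ r, L r i (f (r, j)) k := by
  have h : HasSum (fun l => symbolTranspose A (k - l) * toSymbol f l)
      (Matrix.of fun i j => ∑ r, L r i (f (r, j)) k) :=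
    Pi.hasSum.2 fun i => Pi.hasSum.2 fun j => by
      simpa only [Matrix.mul_apply, Matrix.of_apply, symbolTranspose, Matrix.transpose_apply,
        toSymbol_apply] using hasSum_sum fun r _ => hL r i (f (r, j)) k
  rw [symbolMul, h.tsum_eq, Matrix.of_apply]

theorem ActsBy.hasSum_comm (hL : ActsBy A L) (i j : Fin n) (x : Ell2) (k : ℤ) :
    HasSum (fun l => x (k - l) * A l i j) (L i j x k) := by
  rw [← (Equiv.subLeft k).hasSum_iff]
  simpa [Function.comp_def, mul_comm] using hL i j x k

theorem ActsBy.symbolMul_left (hL : ActsBy A L) (f : MatEll2 n) (k : ℤ) (i j : Fin n) :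
    symbolMul (toSymbol f) A k i j = ∑ r, L r j (f (i, r)) k := by
  have h : HasSum (fun l => toSymbol f (k - l) * A l)
      (Matrix.of fun i j => ∑ r, L r j (f (i, r)) k) :=
    Pi.hasSum.2 fun i => Pi.hasSum.2 fun j => by
      simpa only [Matrix.mul_apply, Matrix.of_apply, toSymbol_apply] using
         hasSum_sum fun r _ => hL.hasSum_comm r j (f (i, r)) k
  rw [symbolMul, h.tsum_eq, Matrix.of_apply]

/-- The `k`-th harmonic `jωk`. -/
def harmonic (T : ℝ) (k : ℤ) : ℂ := Complex.I * ((2 * Real.pi / T : ℝ) : ℂ) * (k : ℂ)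

theorem ActsBy.symbolLyapunov_apply (hL : ActsBy A L) (T : ℝ) (q f : MatEll2 n) (k : ℤ)
    (i j : Fin n) : symbolLyapunov T A (toSymbol q) (toSymbol f) k i j =
      lyapunovOp L f (i, j) k + harmonic T k * f (i, j) k + q (i, j) k := by
  simp only [symbolLyapunov, Pi.add_apply, Matrix.add_apply, hL.symbolMul_transpose,
    hL.symbolMul_left, lyapunovOp_apply]
  rfl

theorem star_harmonic (T : ℝ) (k : ℤ) : star (harmonic T k) = -harmonic T k := by
  simp [harmonic, -Complex.ofReal_div, -Complex.ofReal_mul]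

theorem harmonic_sub (T : ℝ) (k l : ℤ) : harmonic T (k - l) = harmonic T k - harmonic T l := by
  simp [harmonic, mul_sub]

theorem ActsBy.infMul_blockToeplitz_left (hL : ActsBy A L) (T : ℝ) (f : MatEll2 n)
    (p q : Fin n × ℤ) :
    infMul (blockToeplitz (toSymbol f)) (blockToeplitz A - harmonicN n T) p q =
      ∑ r, L r q.1 (f (p.1, r)) (p.2 - q.2) - harmonic T q.2 * f (p.1, q.1) (p.2 - q.2) := by
  have h1 : HasSum (fun r : Fin n × ℤ => f (p.1, r.1) (p.2 - r.2) * A (r.2 - q.2) r.1 q.1)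
      (∑ r, L r q.1 (f (p.1, r)) (p.2 - q.2)) :=
    hasSum_prod_fintype fun r => by
      rw [← (Equiv.subLeft p.2).hasSum_iff]
      refine (hL r q.1 (f (p.1, r)) (p.2 - q.2)).congr_fun fun l => ?_
      simp [mul_comm, sub_right_comm]
  have h2 : HasSum (fun r : Fin n × ℤ => f (p.1, r.1) (p.2 - r.2) * harmonicN n T r q)
      (f (p.1, q.1) (p.2 - q.2) * harmonicN n T q q) :=
    hasSum_single q fun r hr => by simp [harmonicN, Matrix.diagonal_apply_ne _ hr]
  have h := h1.sub h2
  rw [infMul, Matrix.of_apply]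
  refine Eq.trans (HasSum.tsum_eq (h.congr_fun fun r => ?_)) ?_
  · simp [blockToeplitz, mul_sub]
  · simp [harmonicN, harmonic, mul_comm]

theorem ActsBy.infMul_blockToeplitz_right (hL : ActsBy A L)
    (hA : ∀ k i j, star (A k i j) = A (-k) i j) (T : ℝ) (f : MatEll2 n) (p q : Fin n × ℤ) :
    infMul (blockToeplitz A - harmonicN n T)ᴴ (blockToeplitz (toSymbol f)) p q =
      ∑ r, L r p.1 (f (r, q.1)) (p.2 - q.2) + harmonic T p.2 * f (p.1, q.1) (p.2 - q.2) := by
  have h1 : HasSum (fun r : Fin n × ℤ => A (p.2 - r.2) r.1 p.1 * f (r.1, q.1) (r.2 - q.2))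
      (∑ r, L r p.1 (f (r, q.1)) (p.2 - q.2)) :=
    hasSum_prod_fintype fun r => by
      rw [← (Equiv.addRight q.2).hasSum_iff]
      refine (hL r p.1 (f (r, q.1)) (p.2 - q.2)).congr_fun fun l => ?_
      simp [sub_sub, add_comm]
  have h2 : HasSum (fun r : Fin n × ℤ => -star (harmonicN n T r p) * f (r.1, q.1) (r.2 - q.2))
      (-star (harmonicN n T p p) * f (p.1, q.1) (p.2 - q.2)) :=
    hasSum_single p fun r hr => by simp [harmonicN, Matrix.diagonal_apply_ne _ hr]
  have h := h1.add h2
  rw [infMul, Matrix.of_apply]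
  refine Eq.trans (HasSum.tsum_eq (h.congr_fun fun r => ?_)) ?_
  · simp only [blockToeplitz, Matrix.conjTranspose_apply, Matrix.sub_apply, Matrix.of_apply,
      star_sub, hA, neg_sub, toSymbol_apply]
    ring
  · have : harmonicN n T p p = harmonic T p.2 := by simp [harmonicN, harmonic]
    rw [this, star_harmonic, neg_neg]

/-- The two `𝒩` terms contribute `jωk - jωl = jω(k - l)`, so the whole left-hand side is again block
Toeplitz. -/
theorem ActsBy.isHarmonicLyapunovSolution_iff (hL : ActsBy A L)
    (hA : ∀ k i j, star (A k i j) = A (-k) i j) (T : ℝ) (q f : MatEll2 n) :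
    IsHarmonicLyapunovSolution T A (toSymbol q) (toSymbol f) ↔
      ∀ p k, lyapunovOp L f p k + harmonic T k * f p k + q p k = 0 := by
  have key : ∀ a b : Fin n × ℤ, (infMul (blockToeplitz (toSymbol f))
        (blockToeplitz A - harmonicN n T)
      + infMul (blockToeplitz A - harmonicN n T)ᴴ (blockToeplitz (toSymbol f))
      + blockToeplitz (toSymbol q)) a b = lyapunovOp L f (a.1, b.1) (a.2 - b.2) +
        harmonic T (a.2 - b.2) * f (a.1, b.1) (a.2 - b.2) + q (a.1, b.1) (a.2 - b.2) := by
    intro a b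
    rw [Matrix.add_apply, Matrix.add_apply, hL.infMul_blockToeplitz_left,
      hL.infMul_blockToeplitz_right hA, lyapunovOp_apply, harmonic_sub, blockToeplitz,
      Matrix.of_apply, toSymbol_apply]
    ring
  constructor
  · rintro ⟨-, h⟩ p k
    -- The column of index `0` in each block already contains every coefficient.
    have := key (p.1, k) (p.2, 0)
    rw [h] at this
    simpa using this.symm
  · refine fun h => ⟨sqSummable_toSymbol f, ?_⟩
    ext a b
    rw [key, h]
    rfl

/-! ### Compact perturbation, Fredholm alternative and truncation -/

/-- The entrywise action of an operator on `ℓ²(ℤ)`. -/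
def mapEntries (D : Ell2 →L[ℂ] Ell2) : MatEll2 n →L[ℂ] MatEll2 n :=
  ∑ p, ContinuousLinearMap.single ℂ (fun _ : Fin n × Fin n => Ell2) p ∘L D ∘L
    ContinuousLinearMap.proj p

@[simp]
theorem mapEntries_apply (D : Ell2 →L[ℂ] Ell2) (f : MatEll2 n) (p : Fin n × Fin n) :
    mapEntries D f p = D (f p) := by
  simp [mapEntries, Finset.sum_apply]

theorem continuous_mapEntries : Continuous (mapEntries (n := n)) := by
  unfold mapEntries
  fun_prop

theorem isCompactOperator_mapEntries {D : Ell2 →L[ℂ] Ell2} (hD : IsCompactOperator D) :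
    IsCompactOperator (mapEntries (n := n) D) := by
  refine Submodule.sum_mem (compactOperator (RingHom.id ℂ) (MatEll2 n) (MatEll2 n)) fun p _ => ?_
  exact (hD.comp_clm (ContinuousLinearMap.proj (R := ℂ) (φ := fun _ : Fin n × Fin n => Ell2)
    p)).clm_comp (ContinuousLinearMap.single ℂ (fun _ : Fin n × Fin n => Ell2) p)

theorem tendsto_mapEntries_cutoff (f : MatEll2 n) :
    Tendsto (fun m => mapEntries (cutoff m) f) atTop (𝓝 f) := by
  rw [tendsto_pi_nhds]
  intro p
  simpa using tendsto_cutoff_apply (f p)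

theorem one_add_harmonic_re (T : ℝ) (k : ℤ) : (1 + harmonic T k).re = 1 := by
  simp [harmonic, -Complex.ofReal_div, -Complex.ofReal_mul]

theorem one_add_harmonic_im (T : ℝ) (k : ℤ) : (1 + harmonic T k).im = 2 * Real.pi / T * k := by
  simp [harmonic, -Complex.ofReal_div, -Complex.ofReal_mul]

theorem one_add_harmonic_ne_zero (T : ℝ) (k : ℤ) : 1 + harmonic T k ≠ 0 := fun h => by
  simpa only [one_add_harmonic_re, Complex.zero_re, one_ne_zero] using congrArg Complex.re h

theorem norm_inv_one_add_harmonic_le (T : ℝ) (k : ℤ) : ‖(1 + harmonic T k)⁻¹‖ ≤ 1 := by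
  rw [norm_inv]
  refine inv_le_one_of_one_le₀ ?_
  simpa only [one_add_harmonic_re, abs_one] using Complex.abs_re_le_norm (1 + harmonic T k)

/-- The imaginary part gives `|1 + jωk| ≥ ω|k|`. -/
theorem tendsto_inv_one_add_harmonic {T : ℝ} (hT : 0 < T) :
    Tendsto (fun k => (1 + harmonic T k)⁻¹) cofinite (𝓝 0) := by
  refine tendsto_inv₀_cobounded.comp (tendsto_norm_atTop_iff_cobounded.1
    (tendsto_atTop_mono (fun k => Complex.abs_im_le_norm _) ?_))
  have h := (tendsto_norm_comp_cofinite_atTop_of_isClosedEmbedding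
    Int.isClosedEmbedding_coe_real).const_mul_atTop (show 0 < 2 * Real.pi / T by positivity)
  refine h.congr fun k => ?_
  rw [one_add_harmonic_im, abs_mul, abs_of_pos (show 0 < 2 * Real.pi / T by positivity)]
  rfl

/-- The operator `(1 + N)⁻¹`, which divides the coefficients of order `k` by `1 + jωk`. -/
def resolventDiag (T : ℝ) : Ell2 →L[ℂ] Ell2 :=
  diagOp (fun k => (1 + harmonic T k)⁻¹) 1 (norm_inv_one_add_harmonic_le T)

theorem isCompactOperator_resolventDiag {T : ℝ} (hT : 0 < T) :
    IsCompactOperator (resolventDiag T) :=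
  isCompactOperator_of_tendsto
    (tendsto_cutoff_comp_diagOp _ 1 (norm_inv_one_add_harmonic_le T)
      (tendsto_inv_one_add_harmonic hT))
    (Eventually.of_forall fun m => (isCompactOperator_cutoff m).comp_clm _)

/-- The compact perturbation `(1 + N)⁻¹ (M - 1)`, where `M` is the operator `P ↦ A' P + P A`. -/
def perturbation (T : ℝ) (L : Fin n → Fin n → Ell2 →L[ℂ] Ell2) : MatEll2 n →L[ℂ] MatEll2 n :=
  mapEntries (resolventDiag T) ∘L (lyapunovOp L - 1)

theorem perturbation_apply (T : ℝ) (L : Fin n → Fin n → Ell2 →L[ℂ] Ell2) (f : MatEll2 n)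
    (p : Fin n × Fin n) (k : ℤ) :
    perturbation T L f p k = (1 + harmonic T k)⁻¹ * (lyapunovOp L f p k - f p k) := by
  simp [perturbation, resolventDiag, mul_sub]

theorem isCompactOperator_perturbation {T : ℝ} (hT : 0 < T)
    (L : Fin n → Fin n → Ell2 →L[ℂ] Ell2) : IsCompactOperator (perturbation T L) :=
  (isCompactOperator_mapEntries (isCompactOperator_resolventDiag hT)).comp_clm _

theorem add_inv_mul_eq_iff {d : ℂ} (hd : 1 + d ≠ 0) (x y q : ℂ) :
    x + (1 + d)⁻¹ * (y - x) = -((1 + d)⁻¹ * q) ↔ y + d * x + q = 0 := by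
  rw [← mul_right_inj' hd, mul_add, mul_inv_cancel_left₀ hd, mul_neg, mul_inv_cancel_left₀ hd]
  constructor <;> intro h <;> linear_combination h

/-- The Lyapunov equation is satisfied by the coefficients of order `|k| ≤ m`, and the other
coefficients vanish. -/
def IsTruncatedSolution (T : ℝ) (L : Fin n → Fin n → Ell2 →L[ℂ] Ell2) (m : ℕ)
    (q f : MatEll2 n) : Prop :=
  ∀ p k, (k ∈ Finset.Icc (-(m : ℤ)) m → lyapunovOp L f p k + harmonic T k * f p k + q p k = 0) ∧
    (k ∉ Finset.Icc (-(m : ℤ)) m → f p k = 0)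

theorem MatEll2.ext_iff {f g : MatEll2 n} : f = g ↔ ∀ p k, f p k = g p k :=
  ⟨fun h _ _ => h ▸ rfl, fun h => funext fun p => lp.ext (funext (h p))⟩

/-- For `|k| ≤ m`, multiply by `1 + jωk`, nonzero since its real part is `1`; for `|k| > m` the
cut-offs leave only `f p k = 0`. -/
theorem truncated_iff (T : ℝ) (L : Fin n → Fin n → Ell2 →L[ℂ] Ell2) (m : ℕ) (q f : MatEll2 n) :
    (1 + mapEntries (cutoff m) ∘L perturbation T L) f =
        -mapEntries (cutoff m) (mapEntries (resolventDiag T) q) ↔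
      IsTruncatedSolution T L m q f := by
  rw [MatEll2.ext_iff]
  refine forall_congr' fun p => forall_congr' fun k => ?_
  have e1 : (1 + mapEntries (cutoff m) ∘L perturbation T L) f p k =
      f p k + cutoff m (perturbation T L f p) k := by simp
  have e2 : (-mapEntries (cutoff m) (mapEntries (resolventDiag T) q)) p k =
      -cutoff m (resolventDiag T (q p)) k := by simp
  rw [e1, e2, cutoff_apply, cutoff_apply, perturbation_apply]
  by_cases hk : k ∈ Finset.Icc (-(m : ℤ)) m
  · simp only [hk, if_true, not_true, false_imp_iff, true_imp_iff, and_true]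
    exact add_inv_mul_eq_iff (one_add_harmonic_ne_zero T k) _ _ _
  · simp only [hk, if_false, not_false_iff, false_imp_iff, true_imp_iff, true_and, add_zero,
      neg_zero]

/-- By compactness `-1` is either an eigenvalue, whose eigenvector would solve the homogeneous
equation, or a point of the resolvent set. -/
theorem isUnit_one_add_perturbation {T : ℝ} (hT : 0 < T) {L : Fin n → Fin n → Ell2 →L[ℂ] Ell2}
    (hinj : ∀ f : MatEll2 n, (∀ p k, lyapunovOp L f p k + harmonic T k * f p k = 0) → f = 0) :
    IsUnit (1 + perturbation T L) := by
  rcases (isCompactOperator_perturbation hT L).hasEigenvalue_or_mem_resolventSet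
    (neg_ne_zero.2 (one_ne_zero (α := ℂ))) with h | h
  · obtain ⟨f, hf⟩ := h.exists_hasEigenvector
    refine absurd (hinj f fun p k => ?_) hf.2
    have h1 : perturbation T L f = (-1 : ℂ) • f := hf.apply_eq_smul
    have h2 := congrArg (fun g : MatEll2 n => g p k) h1
    simp only [perturbation_apply, Pi.smul_apply, lp.coeFn_smul] at h2
    have h3 := (add_inv_mul_eq_iff (one_add_harmonic_ne_zero T k) (f p k)
      (lyapunovOp L f p k) 0).1 (by rw [h2]; simp)
    simpa using h3
  · rw [spectrum.mem_resolventSet_iff] at h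
    convert h.neg using 1
    simp [add_comm]

/-- The truncated equations are uniquely solvable for large `m`, and their solutions converge. -/
theorem exists_tendsto_truncatedSolution {T : ℝ} (hT : 0 < T)
    {L : Fin n → Fin n → Ell2 →L[ℂ] Ell2}
    (hinj : ∀ f : MatEll2 n, (∀ p k, lyapunovOp L f p k + harmonic T k * f p k = 0) → f = 0)
    (q : MatEll2 n) :
    ∃ (X : ℕ → MatEll2 n) (X₀ : MatEll2 n), Tendsto X atTop (𝓝 X₀) ∧ ∀ᶠ m in atTop,
      IsTruncatedSolution T L m q (X m) ∧ ∀ f, IsTruncatedSolution T L m 0 f → f = 0 := by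
  obtain ⟨u, hu⟩ := isUnit_one_add_perturbation hT hinj
  set F : ℕ → MatEll2 n →L[ℂ] MatEll2 n := fun m => 1 + mapEntries (cutoff m) ∘L perturbation T L
  have hK : Tendsto (fun m => mapEntries (n := n) (cutoff m ∘L resolventDiag T)) atTop
      (𝓝 (mapEntries (resolventDiag T))) :=
    (continuous_mapEntries.tendsto _).comp (tendsto_cutoff_comp_diagOp _ 1 _
      (tendsto_inv_one_add_harmonic hT))
  -- Norm convergence, although the cut-offs converge only strongly: they act after the diagonal
  -- factor with entries tending to zero.
  have hFlim : Tendsto F atTop (𝓝 (u : MatEll2 n →L[ℂ] MatEll2 n)) := by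
    rw [hu]
    refine tendsto_const_nhds.add ?_
    refine (hK.mul_const (lyapunovOp L - 1)).congr fun m => ?_
    ext f p k
    simp [perturbation]
  have hinv : Tendsto (fun m => Ring.inverse (F m)) atTop (𝓝 (Ring.inverse u.val)) :=
    (NormedRing.inverse_continuousAt u).tendsto.comp hFlim
  refine ⟨fun m => Ring.inverse (F m) (-mapEntries (cutoff m) (mapEntries (resolventDiag T) q)),
    Ring.inverse u.val (-mapEntries (resolventDiag T) q),
    (isBoundedBilinearMap_apply.continuous.tendsto _).comp
      (hinv.prodMk_nhds (tendsto_mapEntries_cutoff _).neg), ?_⟩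
  -- The units form an open set, so `F m` is invertible for large `m`.
  filter_upwards [hFlim.eventually (Units.isOpen.mem_nhds u.isUnit)] with m hm
  constructor
  · rw [← truncated_iff]
    exact DFunLike.congr_fun (Ring.mul_inverse_cancel _ hm) _
  · intro f hf
    rw [← truncated_iff] at hf
    have h0 : F m f = 0 := hf.trans (by simp)
    simpa [h0] using (DFunLike.congr_fun (Ring.inverse_mul_cancel _ hm) f).symm

/-! ### The finite matrix of the truncated problem -/

/-- Sums over the modes up to order `m` give the action on sequences supported there. -/
theorem ActsBy.sum_modes (hL : ActsBy A L) {m : ℕ} {x : Ell2}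
    (hx : ∀ k ∉ Finset.Icc (-(m : ℤ)) m, x k = 0) (i j : Fin n) (k : ℤ) :
    ∑ l : Modes m, A (k - l) i j * x l = L i j x k := by
  rw [Finset.sum_coe_sort (Finset.Icc (-(m : ℤ)) m) fun l => A (k - l) i j * x l]
  exact (hasSum_sum_of_ne_finset_zero fun l hl => by rw [hx l hl, mul_zero]).unique (hL i j x k)

theorem truncLyapunovMatrix_apply (hA : ∀ k i j, star (A k i j) = A (-k) i j) (T : ℝ) (m : ℕ)
    (i j i' j' : Fin n) (k k' : Modes m) :
    truncLyapunovMatrix T A m (j, (i, k)) (j', (i', k')) =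
      (if j = j' then A (k - k') i' i else 0) +
        (if j = j' then if i = i' then if k = k' then harmonic T k else 0 else 0 else 0) +
        (if i = i' then A (k - k') j' j else 0) := by
  have hN : star (trunc m (harmonicN n T) (i', k') (i, k)) =
      -if i = i' then if k = k' then harmonic T k else 0 else 0 := by
    by_cases h : i = i' ∧ k = k'
    · obtain ⟨rfl, rfl⟩ := h
      have : trunc m (harmonicN n T) (i, k) (i, k) = harmonic T k := by
        simp [trunc, harmonicN, harmonic]
      rw [this, star_harmonic]
      simp
    · have h' : ((i', (k' : ℤ)) : Fin n × ℤ) ≠ (i, (k : ℤ)) := fun e => h (by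
        simp only [Prod.mk.injEq] at e
        exact ⟨e.1.symm, Subtype.ext e.2.symm⟩)
      have : trunc m (harmonicN n T) (i', k') (i, k) = 0 := by
        rw [trunc, Matrix.submatrix_apply, harmonicN, Matrix.diagonal_apply_ne _ h']
      rw [this, star_zero, ← ite_and, if_neg h, neg_zero]
  have hT : ∀ a b, star (trunc m (blockToeplitz A) (a, k') (b, k)) = A (k - k') a b := fun a b => by
    simp [trunc, blockToeplitz, hA]
  simp only [truncLyapunovMatrix, Matrix.add_apply, Matrix.kroneckerMap_apply, idCirc,
    Matrix.of_apply, Matrix.conjTranspose_apply, Matrix.sub_apply, star_sub, hN, hT,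
    Matrix.one_apply]
  split_ifs <;> simp

/-- On sequences supported in the window the finite sums are the full convolutions, so the matrix is
the compression of `M + N`. -/
theorem ActsBy.truncLyapunovMatrix_mulVec (hL : ActsBy A L)
    (hA : ∀ k i j, star (A k i j) = A (-k) i j) (T : ℝ) {m : ℕ} {f : MatEll2 n}
    (hf : ∀ p, ∀ k ∉ Finset.Icc (-(m : ℤ)) m, f p k = 0) (i j : Fin n) (k : Modes m) :
    (truncLyapunovMatrix T A m *ᵥ colTrunc m (toSymbol f)) (j, (i, k)) =
      lyapunovOp L f (i, j) k + harmonic T k * f (i, j) k := by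
  simp only [Matrix.mulVec, dotProduct, Fintype.sum_prod_type, truncLyapunovMatrix_apply hA,
    colTrunc, toSymbol_apply, add_mul, ite_mul, zero_mul, Finset.sum_add_distrib,
    Finset.sum_ite_irrel, Finset.sum_const_zero, Finset.sum_ite_eq, Finset.mem_univ, if_true,
    hL.sum_modes (hf _), lyapunovOp_apply]
  ring

/-- Every vector of coefficients of order `|k| ≤ m` comes from a matrix of sequences. -/
theorem exists_colTrunc_eq (m : ℕ) (v : Fin n × (Fin n × Modes m) → ℂ) :
    ∃ f : MatEll2 n, (∀ p, ∀ k ∉ Finset.Icc (-(m : ℤ)) m, f p k = 0) ∧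
      colTrunc m (toSymbol f) = v := by
  refine ⟨fun p => ∑ l : Modes m, lp.single 2 (l : ℤ) (v (p.2, (p.1, l))), fun p k hk => ?_, ?_⟩
  · rw [lp.coeFn_sum, Finset.sum_apply]
    refine Finset.sum_eq_zero fun l _ => lp.single_apply_ne _ _ _ fun h => hk (h ▸ l.2)
  · ext ⟨j, i, k⟩
    simp only [colTrunc, toSymbol_apply]
    rw [lp.coeFn_sum, Finset.sum_apply, Finset.sum_eq_single k]
    · exact lp.single_apply_self _ _ _
    · exact fun l _ hl => lp.single_apply_ne _ _ _ fun h => hl (Subtype.ext h.symm)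
    · simp

theorem ActsBy.isUnit_truncLyapunovMatrix (hL : ActsBy A L)
    (hA : ∀ k i j, star (A k i j) = A (-k) i j) {T : ℝ} {m : ℕ}
    (hinj : ∀ f, IsTruncatedSolution T L m 0 f → f = 0) :
    IsUnit (truncLyapunovMatrix T A m) := by
  rw [← Matrix.mulVec_injective_iff_isUnit]
  refine (injective_iff_map_eq_zero (truncLyapunovMatrix T A m).mulVecLin).2 fun v hv => ?_
  obtain ⟨f, hf, rfl⟩ := exists_colTrunc_eq m v
  have h0 : f = 0 := hinj f fun p k => ⟨fun hk => ?_, hf p k⟩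
  · rw [h0]
    rfl
  · have := hL.truncLyapunovMatrix_mulVec hA T hf p.1 p.2 ⟨k, hk⟩
    rw [← Matrix.mulVecLin_apply, hv] at this
    simpa using this.symm

theorem ActsBy.truncSolution_eq (hL : ActsBy A L)
    (hA : ∀ k i j, star (A k i j) = A (-k) i j) {T : ℝ} {m : ℕ} {q f : MatEll2 n}
    (hu : IsUnit (truncLyapunovMatrix T A m)) (hf : IsTruncatedSolution T L m q f) :
    truncSolution T A (toSymbol q) m = toSymbol f := by
  have hcol : -((truncLyapunovMatrix T A m)⁻¹ *ᵥ colTrunc m (toSymbol q)) =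
      colTrunc m (toSymbol f) := by
    have h : truncLyapunovMatrix T A m *ᵥ colTrunc m (toSymbol f) = -colTrunc m (toSymbol q) := by
      ext ⟨j, i, k⟩
      rw [hL.truncLyapunovMatrix_mulVec hA T (fun p k => (hf p k).2)]
      exact eq_neg_of_add_eq_zero_left ((hf (i, j) k).1 k.2)
    rw [← Matrix.mulVec_neg, ← h, Matrix.mulVec_mulVec,
      Matrix.nonsing_inv_mul _ ((Matrix.isUnit_iff_isUnit_det _).1 hu), Matrix.one_mulVec]
  ext k i j
  rw [truncSolution, Matrix.of_apply, hcol]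
  split_ifs with hk
  · rfl
  · exact ((hf (i, j) k).2 hk).symm

/-! ### The residual and its decay -/

/-- Inside the window the residual vanishes; outside, `f` vanishes and so does the unbounded term
`jωk f`. Only bounded operators remain. -/
theorem ActsBy.symbolLyapunov_eq (hL : ActsBy A L) {T : ℝ} {m : ℕ} {q f : MatEll2 n}
    (hf : IsTruncatedSolution T L m q f) :
    symbolLyapunov T A (toSymbol q) (toSymbol f) =
      toSymbol ((lyapunovOp L f + q) - mapEntries (cutoff m) (lyapunovOp L f + q)) := by
  ext k i j
  have h : ((lyapunovOp L f + q) - mapEntries (cutoff m) (lyapunovOp L f + q)) (i, j) k =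
      lyapunovOp L f (i, j) k + q (i, j) k - cutoff m (lyapunovOp L f (i, j) + q (i, j)) k := by
    simp
  rw [hL.symbolLyapunov_apply, toSymbol_apply, h, cutoff_apply]
  split_ifs with hk
  · rw [(hf (i, j) k).1 hk]
    simp
  · rw [(hf (i, j) k).2 hk]
    simp

/-- Strong convergence of the cut-offs handles `Y₀`; their bound `‖cutoff m‖ ≤ 1` handles `Y m -
Y₀`. -/
theorem tendsto_sub_mapEntries_cutoff {Y : ℕ → MatEll2 n} {Y₀ : MatEll2 n}
    (hY : Tendsto Y atTop (𝓝 Y₀)) :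
    Tendsto (fun m => Y m - mapEntries (cutoff m) (Y m)) atTop (𝓝 0) := by
  rw [tendsto_pi_nhds] at hY ⊢
  intro p
  have h1 : Tendsto (fun m => cutoff m (Y m p - Y₀ p)) atTop (𝓝 0) := by
    refine squeeze_zero_norm (fun m => ?_) (tendsto_iff_norm_sub_tendsto_zero.1 (hY p))
    simpa using (cutoff m).le_of_opNorm_le (norm_cutoff_le m) (Y m p - Y₀ p)
  have h2 := ((hY p).sub (tendsto_cutoff_apply (Y₀ p))).sub h1
  rw [sub_self, sub_zero] at h2
  refine h2.congr fun m => ?_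
  simp

end Harmonic

end

open Harmonic MeasureTheory Filter Topology in
theorem mainTheorem11 (n : ℕ) (T : ℝ) (hT : 0 < T)
    (A Q : ℝ → Matrix (Fin n) (Fin n) ℝ)
    (hAper : Function.Periodic A T) (hQper : Function.Periodic Q T)
    (hA : ∀ i j, MeasureTheory.MemLp (fun t => A t i j) ⊤
      (MeasureTheory.volume.restrict (Set.Ioc 0 T)))
    (hQ : ∀ i j, MeasureTheory.MemLp (fun t => Q t i j) ⊤
      (MeasureTheory.volume.restrict (Set.Ioc 0 T)))
    (hP : ∃! P : Harmonic.MatSymbol n, Harmonic.IsHarmonicLyapunovSolution T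
      (Harmonic.symbolOf T A) (Harmonic.symbolOf T Q) P)
    (ε : ℝ) (hε : 0 < ε) :
    ∃ m₀ : ℕ, ∀ m : ℕ, m₀ ≤ m →
      IsUnit (Harmonic.truncLyapunovMatrix T (Harmonic.symbolOf T A) m) ∧
      Harmonic.SqSummable
        (Harmonic.symbolLyapunov T (Harmonic.symbolOf T A) (Harmonic.symbolOf T Q)
          (Harmonic.truncSolution T (Harmonic.symbolOf T A) (Harmonic.symbolOf T Q) m)) ∧
      Harmonic.ell2Norm
        (Harmonic.symbolLyapunov T (Harmonic.symbolOf T A) (Harmonic.symbolOf T Q)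
          (Harmonic.truncSolution T (Harmonic.symbolOf T A) (Harmonic.symbolOf T Q) m)) < ε := by
  have : Fact (0 < T) := ⟨hT⟩
  choose L hL' using fun i j => exists_laurent (T := T) _ (hA i j).ofReal
  choose q hq using fun p : Fin n × Fin n =>
    exists_phasor_ell2 (T := T) _ ((hQ p.1 p.2).ofReal (K := ℂ).mono_exponent le_top)
  have hL : ActsBy (symbolOf T A) L := hL'
  have hQq : symbolOf T Q = toSymbol q := by
    ext k i j
    exact (hq (i, j) k).symm
  have hstar : ∀ k i j, star (symbolOf T A k i j) = symbolOf T A (-k) i j :=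
    fun k i j => star_phasor_ofReal T (fun t => A t i j) k
  rw [hQq] at hP ⊢
  have hinj : ∀ f : MatEll2 n,
      (∀ p k, lyapunovOp L f p k + harmonic T k * f p k = 0) → f = 0 := by
    intro f hf
    obtain ⟨P, hPsol, hPuniq⟩ := hP
    obtain ⟨g, rfl⟩ := hPsol.1.exists_toSymbol
    have hg := (hL.isHarmonicLyapunovSolution_iff hstar T q g).1 hPsol
    -- Adding a homogeneous solution to the given solution yields another one, so uniqueness forces
    -- `f = 0`.
    have h : toSymbol (g + f) = toSymbol g :=
      hPuniq _ ((hL.isHarmonicLyapunovSolution_iff hstar T q (g + f)).2 fun p k => by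
        rw [map_add]
        simp only [Pi.add_apply, lp.coeFn_add]
        linear_combination hg p k + hf p k)
    exact left_eq_add.1 (toSymbol_injective h).symm
  obtain ⟨X, X₀, hX, hev⟩ := exists_tendsto_truncatedSolution hT hinj q
  have hlim := tendsto_ell2Norm_toSymbol (tendsto_sub_mapEntries_cutoff
    ((((lyapunovOp L).continuous.tendsto X₀).comp hX).add_const q))
  obtain ⟨m₀, hm₀⟩ := eventually_atTop.1 (hev.and (hlim.eventually_lt_const hε))
  refine ⟨m₀, fun m hm => ?_⟩
  obtain ⟨⟨hsol, huniq⟩, hlt⟩ := hm₀ m hm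
  have hu := hL.isUnit_truncLyapunovMatrix hstar huniq
  rw [hL.truncSolution_eq hstar hu hsol, hL.symbolLyapunov_eq hsol]
  exact ⟨hu, sqSummable_toSymbol _, hlt⟩
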